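/- For a finite graph $G=(V,E)$ with graph distance $d$, a dominating broadcast is a function $f:V\to\mathbb{N}$ such that for every vertex $u$ there is a vertex $v$ with $f(v)>0$ and $d(u,v)\le f(v)$; the broadcast domination number $\gamma_b(G)$ is the minimum of $\sum_{v\in V} f(v)$ over all dominating broadcasts $f$. A multipacking is a set $M\subseteq V$ such that for every vertex $v$ and every integer $r\ge 1$, at most $r$ elements of $M$ are at distance at most $r$ from $v$; the multipacking number $\mathrm{mp}(G)$ is the maximum size of a multipacking. Let $P_n$ be the path on $n$ vertices and $P_n\Box P_m$ the grid, the Cartesian product of $P_n$ and $P_m$. Theorem. For all integers $n\ge 4$ and $m\ge 4$ with $\{n,m\}\neq\{4,6\}$, $$\mathrm{mp}(P_n\Box P_m)=\gamma_b(P_n\Box P_m)=\left\lfloor \tfrac n2\right\rfloor+\left\lfloor \tfrac m2\right\rfloor .$$ In the exceptional case of $P_4\Box P_6$ (equivalently, $P_6\Box P_4$), $\mathrm{mp}=4$ and $\gamma_b=5$. -/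

import Mathlib

namespace SimpleGraph

variable {V : Type*}

/-- The closed ball of radius `r` around `v`: all vertices at distance at most `r` from `v`
(vertices in another component are at infinite distance). -/
def closedBall (G : SimpleGraph V) (v : V) (r : ℕ) : Set V :=
  {u | G.edist u v ≤ (r : ℕ∞)}

/-- A dominating broadcast: the balls around the vertices `v` of positive power `f v`, with radius
`f v`, cover the graph. -/
def IsDominatingBroadcast (G : SimpleGraph V) (f : V → ℕ) : Prop :=
  ∀ u : V, ∃ v : V, 0 < f v ∧ u ∈ G.closedBall v (f v)

/-- The broadcast (domination) number: the minimum cost `∑ v, f v` of a dominating broadcast. -/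
noncomputable def broadcastNumber (G : SimpleGraph V) [Fintype V] : ℕ :=
  sInf {c : ℕ | ∃ f : V → ℕ, G.IsDominatingBroadcast f ∧ ∑ v, f v = c}

open Classical in
/-- A multipacking: for every vertex `v` and every positive integer `r`, the ball of radius `r`
around `v` contains at most `r` elements of `M`. -/
def IsMultipacking (G : SimpleGraph V) (M : Finset V) : Prop :=
  ∀ (v : V) (r : ℕ), 0 < r → (M.filter (fun u => u ∈ G.closedBall v r)).card ≤ r

/-- The multipacking number: the maximum size of a multipacking. -/
noncomputable def multipackingNumber (G : SimpleGraph V) [Fintype V] : ℕ :=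
  sSup {k : ℕ | ∃ M : Finset V, G.IsMultipacking M ∧ M.card = k}

/-- The minimum in the definition of the broadcast number is attained. -/
theorem isLeast_broadcastNumber (G : SimpleGraph V) [Fintype V] :
    IsLeast {c : ℕ | ∃ f : V → ℕ, G.IsDominatingBroadcast f ∧ ∑ v, f v = c}
      G.broadcastNumber := by
  have hne : {c : ℕ | ∃ f : V → ℕ, G.IsDominatingBroadcast f ∧ ∑ v, f v = c}.Nonempty :=
    ⟨_, fun _ => 1, fun u => ⟨u, Nat.one_pos, by simp [closedBall]⟩, rfl⟩
  exact ⟨Nat.sInf_mem hne, fun c hc => Nat.sInf_le hc⟩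

/-- The maximum in the definition of the multipacking number is attained. -/
theorem isGreatest_multipackingNumber (G : SimpleGraph V) [Fintype V] :
    IsGreatest {k : ℕ | ∃ M : Finset V, G.IsMultipacking M ∧ M.card = k}
      G.multipackingNumber := by
  have hne : {k : ℕ | ∃ M : Finset V, G.IsMultipacking M ∧ M.card = k}.Nonempty :=
    ⟨0, ∅, fun v r _ => by simp, rfl⟩
  have hb : BddAbove {k : ℕ | ∃ M : Finset V, G.IsMultipacking M ∧ M.card = k} :=
    ⟨Fintype.card V, by rintro k ⟨M, -, rfl⟩; exact M.card_le_univ⟩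
  exact ⟨Nat.sSup_mem hne hb, fun k hk => le_csSup hb hk⟩

end SimpleGraph

/-- The grid `P_n □ P_m`: the Cartesian product of the paths on `n` and on `m` vertices. -/
def gridGraph (n m : ℕ) : SimpleGraph (Fin n × Fin m) :=
  (SimpleGraph.pathGraph n).boxProd (SimpleGraph.pathGraph m)

/-! Multipacking and dominating broadcast are dual packing and covering problems, so
`multipackingNumber_le_broadcastNumber` holds in every graph. In the grid a single ball around the
middle vertex costs `n / 2 + m / 2`. It remains to exhibit multipackings of that size.

A multipacking of a grid stays one in any larger grid (`IsPackingList.mono`), so both sides may be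
taken even, apart from a few small grids. The main construction, `pinwheel`, runs around the
boundary in steps of 4, restarting at each corner. It has `2 * (n / 4) + 2 * (m / 4)` points, and a
side of length 2 mod 4 forces extra points near a corner. A ball meets each side in an interval. If
a corner is at distance `D > r` from the centre, the two sides meeting there lose together about `(D
- r) / 2` points, and the distances to opposite corners add up to `n + m - 2`. Adding the losses
over the four corners leaves at most `r` points in the ball.

The pinwheel with an extra point fails for `n = 4`, which gets its own list. In the grid 4 × 6, a
fractional multipacking of weight 9/2 forces cost 5, while five points always overcrowd some ball.
-/

namespace SimpleGraph

/-! ### Duality and invariance under isometries -/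

/-- Weighted duality: if every ball of radius `r` has weight at most `c * r`, then the total weight
is at most `c` times the cost of any dominating broadcast. -/
theorem IsDominatingBroadcast.sum_le_mul_cost {V : Type*} [Fintype V] [DecidableEq V]
    {G : SimpleGraph V} {f : V → ℕ} (hf : G.IsDominatingBroadcast f) (w : V → ℕ) (c : ℕ)
    (s : V → ℕ → Finset V) (hs : ∀ u v r, u ∈ G.closedBall v r → u ∈ s v r)
    (hw : ∀ v r, 0 < r → ∑ u ∈ s v r, w u ≤ c * r) :
    ∑ u, w u ≤ c * ∑ v, f v := by
  -- Each vertex is charged to every ball containing it, and at least one does.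
  calc ∑ u, w u ≤ ∑ u, ∑ v with 0 < f v, if u ∈ s v (f v) then w u else 0 := by
        refine Finset.sum_le_sum fun u _ => ?_
        obtain ⟨v, hv, huv⟩ := hf u
        have := Finset.single_le_sum (f := fun v => if u ∈ s v (f v) then w u else 0)
          (fun v _ => Nat.zero_le _)
          (show v ∈ Finset.univ.filter (fun v => 0 < f v) by simpa using hv)
        simpa [hs _ _ _ huv] using this
    _ = ∑ v with 0 < f v, ∑ u ∈ s v (f v), w u := by
        rw [Finset.sum_comm]
        simp
    _ ≤ ∑ v with 0 < f v, c * f v := Finset.sum_le_sum fun v hv => hw _ _ (by simpa using hv)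
    _ ≤ ∑ v, c * f v := Finset.sum_le_sum_of_subset (Finset.filter_subset _ _)
    _ = c * ∑ v, f v := (Finset.mul_sum ..).symm

theorem multipackingNumber_le_broadcastNumber {V : Type*} [Fintype V] (G : SimpleGraph V) :
    G.multipackingNumber ≤ G.broadcastNumber := by
  classical
  obtain ⟨M, hM, hMc⟩ := G.isGreatest_multipackingNumber.1
  obtain ⟨f, hf, hfc⟩ := G.isLeast_broadcastNumber.1
  rw [← hMc, ← hfc]
  have := hf.sum_le_mul_cost (fun u => if u ∈ M then 1 else 0) 1
    (fun v r => Finset.univ.filter fun u => u ∈ G.closedBall v r) (by simp) (fun v r hr => by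
      have h := hM v r hr
      rw [Finset.sum_ite_mem, Finset.sum_const, one_mul, smul_eq_mul, mul_one]
      refine le_trans (le_of_eq ?_) h
      congr 1
      ext u
      simp [and_comm])
  simpa using this

theorem broadcastNumber_le_of_equiv {V W : Type*} [Fintype V] [Fintype W] {G : SimpleGraph V}
    {H : SimpleGraph W} (e : V ≃ W)
    (he : ∀ u v r, e u ∈ H.closedBall (e v) r ↔ u ∈ G.closedBall v r) :
    H.broadcastNumber ≤ G.broadcastNumber := by
  obtain ⟨f, hf, hfc⟩ := G.isLeast_broadcastNumber.1
  refine H.isLeast_broadcastNumber.2 ⟨f ∘ e.symm, fun u => ?_, ?_⟩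
  · obtain ⟨v, hv, huv⟩ := hf (e.symm u)
    refine ⟨e v, by simpa using hv, ?_⟩
    rw [← he] at huv
    simpa using huv
  · rw [← hfc]
    exact Equiv.sum_comp e.symm f

theorem multipackingNumber_le_of_equiv {V W : Type*} [Fintype V] [Fintype W] {G : SimpleGraph V}
    {H : SimpleGraph W} (e : V ≃ W)
    (he : ∀ u v r, e u ∈ H.closedBall (e v) r ↔ u ∈ G.closedBall v r) :
    G.multipackingNumber ≤ H.multipackingNumber := by
  classical
  obtain ⟨M, hM, hMc⟩ := G.isGreatest_multipackingNumber.1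
  refine H.isGreatest_multipackingNumber.2 ⟨M.map e.toEmbedding, fun v r hr => ?_, by simpa⟩
  refine le_trans (le_of_eq ?_) (hM (e.symm v) r hr)
  rw [Finset.filter_map, Finset.card_map]
  congr 1
  ext u
  simp [← he]

theorem IsMultipacking.subset {V : Type*} {G : SimpleGraph V} {M N : Finset V}
    (hM : G.IsMultipacking M) (h : N ⊆ M) : G.IsMultipacking N := by
  classical
  exact fun v r hr => (Finset.card_le_card (Finset.filter_subset_filter _ h)).trans (hM v r hr)

theorem edist_pathGraph {n : ℕ} (u v : Fin n) : (pathGraph n).edist u v = Nat.dist u v := by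
  apply le_antisymm
  · wlog h : u ≤ v generalizing u v
    · rw [edist_comm, Nat.dist_comm]
      exact this v u (le_of_not_ge h)
    obtain ⟨v, hv⟩ := v
    induction v with
    | zero =>
      obtain rfl : u = ⟨0, hv⟩ := by
        exact Fin.ext (Nat.le_zero.1 h)
      simp
    | succ k ih =>
      obtain h | h := h.eq_or_lt
      · simp [h]
      · have hk : (u : ℕ) ≤ k := Nat.lt_succ_iff.1 h
        refine (SimpleGraph.edist_triangle (v := ⟨k, by omega⟩)).trans ?_
        have h1 : (pathGraph n).edist ⟨k, by omega⟩ ⟨k + 1, hv⟩ = 1 := by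
          rw [edist_eq_one_iff_adj, pathGraph_adj]
          simp
        rw [h1]
        have := ih (by omega) hk
        rw [Nat.dist_eq_sub_of_le hk] at this
        rw [Nat.dist_eq_sub_of_le (show (u : ℕ) ≤ k + 1 by omega)]
        calc _ ≤ ((k - u : ℕ) : ℕ∞) + 1 := by gcongr
          _ = ((k + 1 - u : ℕ) : ℕ∞) := by
            rw [Nat.succ_sub hk]; rfl
  · refine le_iInf fun p => ?_
    rw [Nat.cast_le]
    induction p with
    | nil => simp
    | cons h p ih =>
      rw [pathGraph_adj] at h
      simp only [Walk.length_cons, Nat.dist] at ih ⊢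
      omega

end SimpleGraph

/-! ### The grid in taxicab coordinates and the upper bound -/

/-- The taxicab distance on `ℕ × ℕ`. -/
def taxicab (p q : ℕ × ℕ) : ℕ := Nat.dist p.1 q.1 + Nat.dist p.2 q.2

/-- The coordinates of a vertex of the grid. -/
def gridCoord {n m : ℕ} (p : Fin n × Fin m) : ℕ × ℕ := (p.1, p.2)

theorem gridCoord_injective {n m : ℕ} : Function.Injective (gridCoord (n := n) (m := m)) := by
  rintro ⟨a, b⟩ ⟨c, d⟩ h
  simpa [gridCoord, Fin.ext_iff] using h

theorem mem_closedBall_gridGraph {n m : ℕ} (u v : Fin n × Fin m) (r : ℕ) :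
    u ∈ (gridGraph n m).closedBall v r ↔ taxicab (gridCoord u) (gridCoord v) ≤ r := by
  rw [SimpleGraph.closedBall, Set.mem_ofPred_eq, gridGraph, SimpleGraph.edist_boxProd,
    SimpleGraph.edist_pathGraph, SimpleGraph.edist_pathGraph, ← Nat.cast_add, Nat.cast_le]
  rfl

theorem mem_closedBall_gridGraph_swap {n m : ℕ} (u v : Fin n × Fin m) (r : ℕ) :
    Equiv.prodComm _ _ u ∈ (gridGraph m n).closedBall (Equiv.prodComm _ _ v) r ↔
      u ∈ (gridGraph n m).closedBall v r := by
  simp only [mem_closedBall_gridGraph, taxicab, gridCoord, Equiv.prodComm_apply, Prod.fst_swap,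
    Prod.snd_swap, add_comm]

theorem broadcastNumber_gridGraph_comm (n m : ℕ) :
    (gridGraph n m).broadcastNumber = (gridGraph m n).broadcastNumber :=
  le_antisymm (SimpleGraph.broadcastNumber_le_of_equiv _ mem_closedBall_gridGraph_swap)
    (SimpleGraph.broadcastNumber_le_of_equiv _ mem_closedBall_gridGraph_swap)

theorem multipackingNumber_gridGraph_comm (n m : ℕ) :
    (gridGraph n m).multipackingNumber = (gridGraph m n).multipackingNumber :=
  le_antisymm (SimpleGraph.multipackingNumber_le_of_equiv _ mem_closedBall_gridGraph_swap)
    (SimpleGraph.multipackingNumber_le_of_equiv _ mem_closedBall_gridGraph_swap)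

theorem broadcastNumber_gridGraph_le {n m : ℕ} (hn : 2 ≤ n) (hm : 2 ≤ m) :
    (gridGraph n m).broadcastNumber ≤ n / 2 + m / 2 := by
  let c : Fin n × Fin m := (⟨n / 2, by omega⟩, ⟨m / 2, by omega⟩)
  refine (gridGraph n m).isLeast_broadcastNumber.2
    ⟨Pi.single c (n / 2 + m / 2), fun u => ⟨c, ?_, ?_⟩, by simp⟩
  · rw [Pi.single_eq_same]
    omega
  · rw [Pi.single_eq_same, mem_closedBall_gridGraph]
    obtain ⟨⟨x, hx⟩, y, hy⟩ := u
    simp only [taxicab, gridCoord, Nat.dist, c]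
    omega

/-! ### Multipackings as lists of points -/

/-- A multipacking of the grid, given as a list of points of `ℕ × ℕ`. -/
def IsPackingList (n m : ℕ) (l : List (ℕ × ℕ)) : Prop :=
  (∀ p ∈ l, p.1 < n ∧ p.2 < m) ∧
    ∀ x y r, x < n → y < m → 0 < r → l.countP (fun p => taxicab p (x, y) ≤ r) ≤ r

theorem IsPackingList.nodup {n m : ℕ} {l : List (ℕ × ℕ)} (h : IsPackingList n m l) : l.Nodup := by
  rw [List.nodup_iff_count_le_one]
  intro p
  by_cases hp : p ∈ l
  -- The ball of radius 1 around `p` would already contain two copies of a repeated `p`.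
  · refine le_trans ?_ (h.2 p.1 p.2 1 (h.1 p hp).1 (h.1 p hp).2 one_pos)
    refine List.countP_mono_left fun q _ hq => ?_
    simp only [beq_iff_eq] at hq
    simp [hq, taxicab]
  · simp [List.count_eq_zero_of_not_mem hp]

theorem IsPackingList.length_le {n m : ℕ} {l : List (ℕ × ℕ)} (h : IsPackingList n m l) :
    l.length ≤ (gridGraph n m).multipackingNumber := by
  classical
  refine (gridGraph n m).isGreatest_multipackingNumber.2
    ⟨Finset.univ.filter fun p => gridCoord p ∈ l, fun v r hr => ?_, ?_⟩
  · refine le_trans ?_ (h.2 v.1 v.2 r v.1.2 v.2.2 hr)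
    rw [List.countP_eq_length_filter, ← List.toFinset_card_of_nodup (h.nodup.filter _),
      ← Finset.card_map ⟨gridCoord, gridCoord_injective⟩]
    refine Finset.card_le_card fun p hp => ?_
    simp only [Finset.mem_map, Finset.mem_filter, mem_closedBall_gridGraph] at hp
    obtain ⟨u, ⟨⟨-, hu⟩, huv⟩, rfl⟩ := hp
    simpa using ⟨hu, huv⟩
  · rw [← List.toFinset_card_of_nodup h.nodup,
      ← Finset.card_map ⟨gridCoord, gridCoord_injective⟩]
    congr 1
    ext p
    simp only [Finset.mem_map, Finset.mem_filter, Finset.mem_univ, true_and, List.mem_toFinset,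
      Function.Embedding.coeFn_mk]
    constructor
    · rintro ⟨u, hu, rfl⟩
      exact hu
    · intro hp
      exact ⟨(⟨p.1, (h.1 p hp).1⟩, ⟨p.2, (h.1 p hp).2⟩), hp, rfl⟩

theorem IsPackingList.swap {n m : ℕ} {l : List (ℕ × ℕ)} (h : IsPackingList n m l) :
    IsPackingList m n (l.map Prod.swap) := by
  refine ⟨fun p hp => ?_, fun x y r hx hy hr => ?_⟩
  · obtain ⟨q, hq, rfl⟩ := List.mem_map.1 hp
    exact (h.1 q hq).symm
  · refine le_trans (le_of_eq ?_) (h.2 y x r hy hx hr)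
    rw [List.countP_map]
    refine List.countP_congr fun p _ => ?_
    rw [Function.comp_apply, decide_eq_true_iff, decide_eq_true_iff]
    simp [taxicab, add_comm]

theorem IsPackingList.succ_left {n m : ℕ} {l : List (ℕ × ℕ)} (h : IsPackingList n m l)
    (hn : 0 < n) : IsPackingList (n + 1) m l := by
  refine ⟨fun p hp => ⟨(h.1 p hp).1.trans n.lt_succ_self, (h.1 p hp).2⟩,
    fun x y r hx hy hr => ?_⟩
  -- Projecting the centre onto the smaller grid does not increase its distance to any point there.
  refine le_trans ?_ (h.2 (min x (n - 1)) y r (by omega) hy hr)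
  refine List.countP_mono_left fun p hp hpr => ?_
  have := (h.1 p hp).1
  replace hpr := of_decide_eq_true hpr
  apply decide_eq_true
  simp only [taxicab, Nat.dist] at hpr ⊢
  omega

theorem IsPackingList.succ_right {n m : ℕ} {l : List (ℕ × ℕ)} (h : IsPackingList n m l)
    (hm : 0 < m) : IsPackingList n (m + 1) l := by
  simpa using (h.swap.succ_left hm).swap

theorem IsPackingList.mono {n m n' m' : ℕ} {l : List (ℕ × ℕ)} (h : IsPackingList n m l)
    (hn0 : 0 < n) (hm0 : 0 < m) (hn : n ≤ n') (hm : m ≤ m') : IsPackingList n' m' l := by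
  have h' : IsPackingList n' m l := by
    induction n', hn using Nat.le_induction with
    | base => exact h
    | succ k hk ih => exact ih.succ_left (hn0.trans_le hk)
  clear h
  induction m', hm using Nat.le_induction with
  | base => exact h'
  | succ k hk ih => exact ih.succ_right (hm0.trans_le hk)

/-! ### The trace of a ball on one side -/

/-- Of `K` terms of a progression with difference `4` starting at `0`, at most `c` lie at distance
at most `r - d` from `z`, since `a` initial and `b` final terms do not. -/
structure WindowBound (K z d r c a b : ℕ) : Prop where
  le : c + a + b ≤ K
  left : z + d ≤ 4 * a + r
  right : 4 * K + d ≤ 4 * b + 4 + z + r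

/-- The numbers `a` and `b` are the least allowed by `left` and `right`, that is, rounded-up
quarters. A nonzero count is needed for `le`: if the ball misses all the terms, `a + b` may exceed
`K`. -/
theorem exists_windowBound (K z d r : ℕ)
    (h : (List.range K).countP (fun t => Nat.dist (4 * t) z + d ≤ r) ≠ 0) :
    ∃ a b, WindowBound K z d r
      ((List.range K).countP (fun t => Nat.dist (4 * t) z + d ≤ r)) a b := by
  obtain ⟨t, ht, htr⟩ := List.countP_pos_iff.1 (Nat.pos_of_ne_zero h)
  simp only [List.mem_range, decide_eq_true_eq] at ht htr
  simp only [Nat.dist] at htr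
  refine ⟨(z + d - r + 3) / 4, (4 * K + d - 4 - z - r + 3) / 4, ?_, by omega, by omega⟩
  rw [List.countP_eq_length_filter, ← List.toFinset_card_of_nodup (List.nodup_range.filter _)]
  have hsub : ((List.range K).filter (fun t => Nat.dist (4 * t) z + d ≤ r)).toFinset ⊆
      Finset.Ico ((z + d - r + 3) / 4) (K - (4 * K + d - 4 - z - r + 3) / 4) := by
    intro s hs
    simp only [List.mem_toFinset, List.mem_filter, List.mem_range, decide_eq_true_eq] at hs
    simp only [Nat.dist] at hs
    rw [Finset.mem_Ico]
    omega
  have := Finset.card_le_card hsub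
  rw [Nat.card_Ico] at this
  omega

/-- Some term is within `g` of `z`. In the applications `g` can be the gap between the last term and
the far corner: 3 on a side of length `4 * K`, and 5 on one of length `4 * K + 2`. -/
theorem lt_add_of_countP_range_eq_zero {K z d r g : ℕ} (hK : 1 ≤ K) (hg : 3 ≤ g)
    (hz : z + 4 ≤ 4 * K + g)
    (h : (List.range K).countP (fun t => Nat.dist (4 * t) z + d ≤ r) = 0) : r < d + g := by
  rw [List.countP_eq_zero] at h
  have := h (min (z / 4) (K - 1)) (List.mem_range.2 (by omega))
  simp only [decide_eq_true_eq] at this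
  simp only [Nat.dist] at this
  omega

/-! ### Counting for the plain pinwheel -/

/-- Put `N = 2 * K + 2 * L`, and let `e1`, ..., `e4` be the losses at the corners. Opposite corners
have distances adding up to `2 * N - 2`, so each diagonal loses at least `N - r - 2` points, which
suffices if `N - r ≥ 4`. For larger `r` it matters that a corner outside the ball loses at least one
point; when `r = N - 1`, parity keeps some corner outside. -/
theorem pinwheel_count_le_zero_zero_of_all_met
    {K L x u y w r c1 a1 b1 c2 a2 b2 c3 a3 b3 c4 a4 b4 : ℕ} (hx : x + u + 1 = 4 * L)
    (hy : y + w + 1 = 4 * K) (h1 : WindowBound K y x r c1 a1 b1)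
    (h2 : WindowBound L x w r c2 a2 b2) (h3 : WindowBound K w u r c3 a3 b3)
    (h4 : WindowBound L u y r c4 a4 b4) :
    c1 + c2 + c3 + c4 ≤ r := by
  obtain ⟨h1, p1, q1⟩ := h1
  obtain ⟨h2, p2, q2⟩ := h2
  obtain ⟨h3, p3, q3⟩ := h3
  obtain ⟨h4, p4, q4⟩ := h4
  obtain ⟨e1, he1⟩ : ∃ e, e = a1 + b4 := ⟨_, rfl⟩
  -- Here `x + y` is the distance to the corner. One side gives `x + y ≤ 4 * a1 + r`, the other `x +
  -- y ≤ 4 * b4 + 3 + r`; the claim is their average.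
  have k1 : x + y ≤ 2 * e1 + 1 + r ∧ (e1 = 0 → x + y ≤ r) := by omega
  obtain ⟨e2, he2⟩ : ∃ e, e = a2 + b1 := ⟨_, rfl⟩
  have k2 : x + w ≤ 2 * e2 + 1 + r ∧ (e2 = 0 → x + w ≤ r) := by omega
  obtain ⟨e3, he3⟩ : ∃ e, e = a3 + b2 := ⟨_, rfl⟩
  have k3 : u + w ≤ 2 * e3 + 1 + r ∧ (e3 = 0 → u + w ≤ r) := by omega
  obtain ⟨e4, he4⟩ : ∃ e, e = a4 + b3 := ⟨_, rfl⟩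
  have k4 : u + y ≤ 2 * e4 + 1 + r ∧ (e4 = 0 → u + y ≤ r) := by omega
  have htot : c1 + c2 + c3 + c4 + e1 + e2 + e3 + e4 ≤ 2 * K + 2 * L := by omega
  generalize c1 + c2 + c3 + c4 = c at *
  clear h1 p1 q1 h2 p2 q2 h3 p3 q3 h4 p4 q4 he1 he2 he3 he4
  omega

/-- The count for balls against the pinwheel when both sides are divisible by `4`. Here `x`, `w`, `u`,
`y` are the distances of the centre from the top, right, bottom and left side, and `r` is the
radius. -/
theorem pinwheel_count_le_zero_zero {K L x u y w r c1 c2 c3 c4 : ℕ}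
    (hL : 1 ≤ L)
    (hx : x + u + 1 = 4 * L) (hy : y + w + 1 = 4 * K) (hr : 1 ≤ r)
    (h1 : (c1 = 0 ∧ r < x + 3) ∨ ∃ a b, WindowBound K y x r c1 a b)
    (h2 : (c2 = 0 ∧ r < w + 3) ∨ ∃ a b, WindowBound L x w r c2 a b)
    (h3 : (c3 = 0 ∧ r < u + 3) ∨ ∃ a b, WindowBound K w u r c3 a b)
    (h4 : (c4 = 0 ∧ r < y + 3) ∨ ∃ a b, WindowBound L u y r c4 a b) :
    c1 + c2 + c3 + c4 ≤ r := by
  rcases h1 with ⟨rfl, h1⟩ | ⟨a1, b1, h1⟩ <;> rcases h2 with ⟨rfl, h2⟩ | ⟨a2, b2, h2⟩ <;>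
    rcases h3 with ⟨rfl, h3⟩ | ⟨a3, b3, h3⟩ <;> rcases h4 with ⟨rfl, h4⟩ | ⟨a4, b4, h4⟩
  · omega
  · obtain ⟨h4, p4, q4⟩ := h4
    omega
  · obtain ⟨h3, p3, q3⟩ := h3
    omega
  · obtain ⟨h3, p3, q3⟩ := h3
    obtain ⟨h4, p4, q4⟩ := h4
    omega
  · obtain ⟨h2, p2, q2⟩ := h2
    omega
  · obtain ⟨h2, p2, q2⟩ := h2
    obtain ⟨h4, p4, q4⟩ := h4
    omega
  · obtain ⟨h2, p2, q2⟩ := h2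
    obtain ⟨h3, p3, q3⟩ := h3
    omega
  · obtain ⟨h2, p2, q2⟩ := h2
    obtain ⟨h3, p3, q3⟩ := h3
    obtain ⟨h4, p4, q4⟩ := h4
    omega
  · obtain ⟨h1, p1, q1⟩ := h1
    omega
  · obtain ⟨h1, p1, q1⟩ := h1
    obtain ⟨h4, p4, q4⟩ := h4
    omega
  · obtain ⟨h1, p1, q1⟩ := h1
    obtain ⟨h3, p3, q3⟩ := h3
    omega
  · obtain ⟨h1, p1, q1⟩ := h1
    obtain ⟨h3, p3, q3⟩ := h3
    obtain ⟨h4, p4, q4⟩ := h4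
    omega
  · obtain ⟨h1, p1, q1⟩ := h1
    obtain ⟨h2, p2, q2⟩ := h2
    omega
  · obtain ⟨h1, p1, q1⟩ := h1
    obtain ⟨h2, p2, q2⟩ := h2
    obtain ⟨h4, p4, q4⟩ := h4
    omega
  · obtain ⟨h1, p1, q1⟩ := h1
    obtain ⟨h2, p2, q2⟩ := h2
    obtain ⟨h3, p3, q3⟩ := h3
    omega
  · exact pinwheel_count_le_zero_zero_of_all_met hx hy h1 h2 h3 h4

/-! ### Counting with one extra point -/

/-- The gap 5 at the ends of the top and bottom sides weakens the constant 1 to 2 at the top right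
and bottom left corners. The extra point, at distance 3 from the top right corner, restores the
constant there. -/
theorem pinwheel_count_le_zero_two_of_all_met
    {K L x u y w r c1 a1 b1 c2 a2 b2 c3 a3 b3 c4 a4 b4 s : ℕ} (hx : x + u + 1 = 4 * L)
    (hy : y + w + 1 = 4 * K + 2) (h1 : WindowBound K y x r c1 a1 b1)
    (h2 : WindowBound L x w r c2 a2 b2) (h3 : WindowBound K w u r c3 a3 b3)
    (h4 : WindowBound L u y r c4 a4 b4)
    (hs : s = 0 ∨ s = 1 ∧ x + w ≤ r + 3 ∧ x + 2 ≤ r + 1 + w ∧ 1 + w ≤ x + r + 2 ∧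
      3 ≤ x + w + r) :
    c1 + c2 + c3 + c4 + s ≤ r := by
  obtain ⟨h1, p1, q1⟩ := h1
  obtain ⟨h2, p2, q2⟩ := h2
  obtain ⟨h3, p3, q3⟩ := h3
  obtain ⟨h4, p4, q4⟩ := h4
  obtain ⟨e1, he1⟩ : ∃ e, e = a1 + b4 := ⟨_, rfl⟩
  have k1 : x + y ≤ 2 * e1 + 1 + r ∧ (e1 = 0 → x + y ≤ r) := by omega
  -- The loss at this corner includes the extra point when `s = 0`.
  obtain ⟨e2, he2⟩ : ∃ e, e + s = a2 + b1 + 1 := ⟨a2 + b1 + 1 - s, by omega⟩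
  have k2 : x + w ≤ 2 * e2 + 1 + r ∧ (e2 = 0 → x + w ≤ r) := by omega
  obtain ⟨e3, he3⟩ : ∃ e, e = a3 + b2 := ⟨_, rfl⟩
  have k3 : u + w ≤ 2 * e3 + 1 + r ∧ (e3 = 0 → u + w ≤ r) := by omega
  obtain ⟨e4, he4⟩ : ∃ e, e = a4 + b3 := ⟨_, rfl⟩
  have k4 : u + y ≤ 2 * e4 + 2 + r ∧ (e4 = 0 → u + y ≤ r) := by omega
  have htot : c1 + c2 + c3 + c4 + s + e1 + e2 + e3 + e4 ≤ 2 * K + 2 * L + 1 := by omega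
  generalize c1 + c2 + c3 + c4 + s = c at *
  clear h1 p1 q1 h2 p2 q2 h3 p3 q3 h4 p4 q4 he1 he2 he3 he4 hs
  omega

/-- The count for the pinwheel with one more point, when `n % 4 = 0` and `m % 4 = 2`. -/
theorem pinwheel_count_le_zero_two {K L x u y w r c1 c2 c3 c4 s : ℕ}
    (hK : 1 ≤ K) (hL : 2 ≤ L)
    (hx : x + u + 1 = 4 * L) (hy : y + w + 1 = 4 * K + 2) (hr : 1 ≤ r)
    (h1 : (c1 = 0 ∧ r < x + 5) ∨ ∃ a b, WindowBound K y x r c1 a b)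
    (h2 : (c2 = 0 ∧ r < w + 3) ∨ ∃ a b, WindowBound L x w r c2 a b)
    (h3 : (c3 = 0 ∧ r < u + 5) ∨ ∃ a b, WindowBound K w u r c3 a b)
    (h4 : (c4 = 0 ∧ r < y + 3) ∨ ∃ a b, WindowBound L u y r c4 a b)
    (hs : s = 0 ∨ s = 1 ∧ x + w ≤ r + 3 ∧ x + 2 ≤ r + 1 + w ∧ 1 + w ≤ x + r + 2 ∧
      3 ≤ x + w + r) :
    c1 + c2 + c3 + c4 + s ≤ r := by
  rcases h1 with ⟨rfl, h1⟩ | ⟨a1, b1, h1⟩ <;> rcases h2 with ⟨rfl, h2⟩ | ⟨a2, b2, h2⟩ <;>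
    rcases h3 with ⟨rfl, h3⟩ | ⟨a3, b3, h3⟩ <;> rcases h4 with ⟨rfl, h4⟩ | ⟨a4, b4, h4⟩
  · rcases hs with rfl | ⟨rfl, hs⟩
    · omega
    · omega
  · obtain ⟨h4, p4, q4⟩ := h4
    rcases hs with rfl | ⟨rfl, hs⟩
    · omega
    · omega
  · obtain ⟨h3, p3, q3⟩ := h3
    rcases hs with rfl | ⟨rfl, hs⟩
    · omega
    · omega
  · obtain ⟨h3, p3, q3⟩ := h3
    obtain ⟨h4, p4, q4⟩ := h4
    -- A corner next to a missed side is charged to its other side alone, which loses about a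
    -- quarter of the excess distance instead of half. In exchange the missed side drops out of the
    -- total `htot`.
    obtain ⟨e1, he1⟩ : ∃ e, e = b4 := ⟨_, rfl⟩
    have k1 : x + y ≤ 4 * e1 + 3 + r := by omega
    obtain ⟨e3, he3⟩ : ∃ e, e = a3 := ⟨_, rfl⟩
    have k3 : u + w ≤ 4 * e3 + r := by omega
    obtain ⟨e4, he4⟩ : ∃ e, e = a4 + b3 := ⟨_, rfl⟩
    have k4 : u + y ≤ 2 * e4 + 2 + r ∧ (e4 = 0 → u + y ≤ r) := by omega
    have htot : 0 + 0 + c3 + c4 + e1 + e3 + e4 ≤ K + L := by omega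
    generalize 0 + 0 + c3 + c4 = c at *
    clear h3 p3 q3 h4 p4 q4 he1 he3 he4
    rcases hs with rfl | ⟨rfl, hs⟩
    · omega
    · omega
  · obtain ⟨h2, p2, q2⟩ := h2
    rcases hs with rfl | ⟨rfl, hs⟩
    · omega
    · omega
  · obtain ⟨h2, p2, q2⟩ := h2
    obtain ⟨h4, p4, q4⟩ := h4
    obtain ⟨e1, he1⟩ : ∃ e, e = b4 := ⟨_, rfl⟩
    have k1 : x + y ≤ 4 * e1 + 3 + r := by omega
    obtain ⟨e2, he2⟩ : ∃ e, e = a2 := ⟨_, rfl⟩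
    have k2 : x + w ≤ 4 * e2 + r := by omega
    obtain ⟨e3, he3⟩ : ∃ e, e = b2 := ⟨_, rfl⟩
    have k3 : u + w ≤ 4 * e3 + 3 + r := by omega
    obtain ⟨e4, he4⟩ : ∃ e, e = a4 := ⟨_, rfl⟩
    have k4 : u + y ≤ 4 * e4 + r := by omega
    have htot : 0 + c2 + 0 + c4 + e1 + e2 + e3 + e4 ≤ L + L := by omega
    generalize 0 + c2 + 0 + c4 = c at *
    clear h2 p2 q2 h4 p4 q4 he1 he2 he3 he4
    rcases hs with rfl | ⟨rfl, hs⟩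
    · omega
    · omega
  · obtain ⟨h2, p2, q2⟩ := h2
    obtain ⟨h3, p3, q3⟩ := h3
    obtain ⟨e2, he2⟩ : ∃ e, e = a2 := ⟨_, rfl⟩
    have k2 : x + w ≤ 4 * e2 + r := by omega
    obtain ⟨e3, he3⟩ : ∃ e, e = a3 + b2 := ⟨_, rfl⟩
    have k3 : u + w ≤ 2 * e3 + 1 + r ∧ (e3 = 0 → u + w ≤ r) := by omega
    obtain ⟨e4, he4⟩ : ∃ e, e = b3 := ⟨_, rfl⟩
    have k4 : u + y ≤ 4 * e4 + 5 + r := by omega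
    have htot : 0 + c2 + c3 + 0 + e2 + e3 + e4 ≤ L + K := by omega
    generalize 0 + c2 + c3 + 0 = c at *
    clear h2 p2 q2 h3 p3 q3 he2 he3 he4
    rcases hs with rfl | ⟨rfl, hs⟩
    · omega
    · omega
  · obtain ⟨h2, p2, q2⟩ := h2
    obtain ⟨h3, p3, q3⟩ := h3
    obtain ⟨h4, p4, q4⟩ := h4
    obtain ⟨e1, he1⟩ : ∃ e, e = b4 := ⟨_, rfl⟩
    have k1 : x + y ≤ 4 * e1 + 3 + r := by omega
    obtain ⟨e2, he2⟩ : ∃ e, e = a2 := ⟨_, rfl⟩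
    have k2 : x + w ≤ 4 * e2 + r := by omega
    obtain ⟨e3, he3⟩ : ∃ e, e = a3 + b2 := ⟨_, rfl⟩
    have k3 : u + w ≤ 2 * e3 + 1 + r ∧ (e3 = 0 → u + w ≤ r) := by omega
    obtain ⟨e4, he4⟩ : ∃ e, e = a4 + b3 := ⟨_, rfl⟩
    have k4 : u + y ≤ 2 * e4 + 2 + r ∧ (e4 = 0 → u + y ≤ r) := by omega
    have htot : 0 + c2 + c3 + c4 + e1 + e2 + e3 + e4 ≤ L + K + L := by omega
    generalize 0 + c2 + c3 + c4 = c at *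
    clear h2 p2 q2 h3 p3 q3 h4 p4 q4 he1 he2 he3 he4
    rcases hs with rfl | ⟨rfl, hs⟩
    · omega
    · omega
  · obtain ⟨h1, p1, q1⟩ := h1
    rcases hs with rfl | ⟨rfl, hs⟩
    · omega
    · omega
  · obtain ⟨h1, p1, q1⟩ := h1
    obtain ⟨h4, p4, q4⟩ := h4
    obtain ⟨e1, he1⟩ : ∃ e, e = a1 + b4 := ⟨_, rfl⟩
    have k1 : x + y ≤ 2 * e1 + 1 + r ∧ (e1 = 0 → x + y ≤ r) := by omega
    obtain ⟨e2, he2⟩ : ∃ e, e = b1 := ⟨_, rfl⟩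
    have k2 : x + w ≤ 4 * e2 + 5 + r := by omega
    obtain ⟨e4, he4⟩ : ∃ e, e = a4 := ⟨_, rfl⟩
    have k4 : u + y ≤ 4 * e4 + r := by omega
    have htot : c1 + 0 + 0 + c4 + e1 + e2 + e4 ≤ K + L := by omega
    generalize c1 + 0 + 0 + c4 = c at *
    clear h1 p1 q1 h4 p4 q4 he1 he2 he4
    rcases hs with rfl | ⟨rfl, hs⟩
    · omega
    · omega
  · obtain ⟨h1, p1, q1⟩ := h1
    obtain ⟨h3, p3, q3⟩ := h3
    obtain ⟨e1, he1⟩ : ∃ e, e = a1 := ⟨_, rfl⟩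
    have k1 : x + y ≤ 4 * e1 + r := by omega
    obtain ⟨e2, he2⟩ : ∃ e, e = b1 := ⟨_, rfl⟩
    have k2 : x + w ≤ 4 * e2 + 5 + r := by omega
    obtain ⟨e3, he3⟩ : ∃ e, e = a3 := ⟨_, rfl⟩
    have k3 : u + w ≤ 4 * e3 + r := by omega
    obtain ⟨e4, he4⟩ : ∃ e, e = b3 := ⟨_, rfl⟩
    have k4 : u + y ≤ 4 * e4 + 5 + r := by omega
    have htot : c1 + 0 + c3 + 0 + e1 + e2 + e3 + e4 ≤ K + K := by omega
    generalize c1 + 0 + c3 + 0 = c at *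
    clear h1 p1 q1 h3 p3 q3 he1 he2 he3 he4
    rcases hs with rfl | ⟨rfl, hs⟩
    · omega
    · omega
  · obtain ⟨h1, p1, q1⟩ := h1
    obtain ⟨h3, p3, q3⟩ := h3
    obtain ⟨h4, p4, q4⟩ := h4
    obtain ⟨e1, he1⟩ : ∃ e, e = a1 + b4 := ⟨_, rfl⟩
    have k1 : x + y ≤ 2 * e1 + 1 + r ∧ (e1 = 0 → x + y ≤ r) := by omega
    obtain ⟨e2, he2⟩ : ∃ e, e = b1 := ⟨_, rfl⟩
    have k2 : x + w ≤ 4 * e2 + 5 + r := by omega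
    obtain ⟨e3, he3⟩ : ∃ e, e = a3 := ⟨_, rfl⟩
    have k3 : u + w ≤ 4 * e3 + r := by omega
    obtain ⟨e4, he4⟩ : ∃ e, e = a4 + b3 := ⟨_, rfl⟩
    have k4 : u + y ≤ 2 * e4 + 2 + r ∧ (e4 = 0 → u + y ≤ r) := by omega
    have htot : c1 + 0 + c3 + c4 + e1 + e2 + e3 + e4 ≤ K + K + L := by omega
    generalize c1 + 0 + c3 + c4 = c at *
    clear h1 p1 q1 h3 p3 q3 h4 p4 q4 he1 he2 he3 he4
    rcases hs with rfl | ⟨rfl, hs⟩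
    · omega
    · omega
  · obtain ⟨h1, p1, q1⟩ := h1
    obtain ⟨h2, p2, q2⟩ := h2
    obtain ⟨e1, he1⟩ : ∃ e, e = a1 := ⟨_, rfl⟩
    have k1 : x + y ≤ 4 * e1 + r := by omega
    obtain ⟨e2, he2⟩ : ∃ e, e = a2 + b1 := ⟨_, rfl⟩
    have k2 : x + w ≤ 2 * e2 + 2 + r ∧ (e2 = 0 → x + w ≤ r) := by omega
    obtain ⟨e3, he3⟩ : ∃ e, e = b2 := ⟨_, rfl⟩
    have k3 : u + w ≤ 4 * e3 + 3 + r := by omega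
    have htot : c1 + c2 + 0 + 0 + e1 + e2 + e3 ≤ K + L := by omega
    generalize c1 + c2 + 0 + 0 = c at *
    clear h1 p1 q1 h2 p2 q2 he1 he2 he3
    rcases hs with rfl | ⟨rfl, hs⟩
    · omega
    · omega
  · obtain ⟨h1, p1, q1⟩ := h1
    obtain ⟨h2, p2, q2⟩ := h2
    obtain ⟨h4, p4, q4⟩ := h4
    obtain ⟨e1, he1⟩ : ∃ e, e = a1 + b4 := ⟨_, rfl⟩
    have k1 : x + y ≤ 2 * e1 + 1 + r ∧ (e1 = 0 → x + y ≤ r) := by omega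
    obtain ⟨e2, he2⟩ : ∃ e, e = a2 + b1 := ⟨_, rfl⟩
    have k2 : x + w ≤ 2 * e2 + 2 + r ∧ (e2 = 0 → x + w ≤ r) := by omega
    obtain ⟨e3, he3⟩ : ∃ e, e = b2 := ⟨_, rfl⟩
    have k3 : u + w ≤ 4 * e3 + 3 + r := by omega
    obtain ⟨e4, he4⟩ : ∃ e, e = a4 := ⟨_, rfl⟩
    have k4 : u + y ≤ 4 * e4 + r := by omega
    have htot : c1 + c2 + 0 + c4 + e1 + e2 + e3 + e4 ≤ K + L + L := by omega
    generalize c1 + c2 + 0 + c4 = c at *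
    clear h1 p1 q1 h2 p2 q2 h4 p4 q4 he1 he2 he3 he4
    rcases hs with rfl | ⟨rfl, hs⟩
    · omega
    · omega
  · obtain ⟨h1, p1, q1⟩ := h1
    obtain ⟨h2, p2, q2⟩ := h2
    obtain ⟨h3, p3, q3⟩ := h3
    obtain ⟨e1, he1⟩ : ∃ e, e = a1 := ⟨_, rfl⟩
    have k1 : x + y ≤ 4 * e1 + r := by omega
    obtain ⟨e2, he2⟩ : ∃ e, e = a2 + b1 := ⟨_, rfl⟩
    have k2 : x + w ≤ 2 * e2 + 2 + r ∧ (e2 = 0 → x + w ≤ r) := by omega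
    obtain ⟨e3, he3⟩ : ∃ e, e = a3 + b2 := ⟨_, rfl⟩
    have k3 : u + w ≤ 2 * e3 + 1 + r ∧ (e3 = 0 → u + w ≤ r) := by omega
    obtain ⟨e4, he4⟩ : ∃ e, e = b3 := ⟨_, rfl⟩
    have k4 : u + y ≤ 4 * e4 + 5 + r := by omega
    have htot : c1 + c2 + c3 + 0 + e1 + e2 + e3 + e4 ≤ K + L + K := by omega
    generalize c1 + c2 + c3 + 0 = c at *
    clear h1 p1 q1 h2 p2 q2 h3 p3 q3 he1 he2 he3 he4
    rcases hs with rfl | ⟨rfl, hs⟩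
    · omega
    · omega
  · exact pinwheel_count_le_zero_two_of_all_met hx hy h1 h2 h3 h4 hs

/-! ### Counting with two extra points -/

/-- All four corners now have a gap of 5. Extra points at two opposite corners restore the constant
1 on one diagonal; the other keeps the constant 2. -/
theorem pinwheel_count_le_two_two_of_all_met
    {K L x u y w r c1 a1 b1 c2 a2 b2 c3 a3 b3 c4 a4 b4 s s' : ℕ} (hx : x + u + 1 = 4 * L + 2)
    (hy : y + w + 1 = 4 * K + 2) (h1 : WindowBound K y x r c1 a1 b1)
    (h2 : WindowBound L x w r c2 a2 b2) (h3 : WindowBound K w u r c3 a3 b3)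
    (h4 : WindowBound L u y r c4 a4 b4)
    (hs : s = 0 ∨ s = 1 ∧ x + w ≤ r + 3 ∧ x + 2 ≤ r + 1 + w ∧ 1 + w ≤ x + r + 2 ∧
      3 ≤ x + w + r)
    (hs' : s' = 0 ∨ s' = 1 ∧ u + y ≤ r + 3 ∧ u + 2 ≤ r + 1 + y ∧ 1 + y ≤ u + r + 2 ∧
      3 ≤ u + y + r) :
    c1 + c2 + c3 + c4 + s + s' ≤ r := by
  obtain ⟨h1, p1, q1⟩ := h1
  obtain ⟨h2, p2, q2⟩ := h2
  obtain ⟨h3, p3, q3⟩ := h3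
  obtain ⟨h4, p4, q4⟩ := h4
  obtain ⟨e1, he1⟩ : ∃ e, e = a1 + b4 := ⟨_, rfl⟩
  have k1 : x + y ≤ 2 * e1 + 2 + r ∧ (e1 = 0 → x + y ≤ r) := by omega
  obtain ⟨e2, he2⟩ : ∃ e, e + s = a2 + b1 + 1 := ⟨a2 + b1 + 1 - s, by omega⟩
  have k2 : x + w ≤ 2 * e2 + 1 + r ∧ (e2 = 0 → x + w ≤ r) := by omega
  obtain ⟨e3, he3⟩ : ∃ e, e = a3 + b2 := ⟨_, rfl⟩
  have k3 : u + w ≤ 2 * e3 + 2 + r ∧ (e3 = 0 → u + w ≤ r) := by omega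
  obtain ⟨e4, he4⟩ : ∃ e, e + s' = a4 + b3 + 1 := ⟨a4 + b3 + 1 - s', by omega⟩
  have k4 : u + y ≤ 2 * e4 + 1 + r ∧ (e4 = 0 → u + y ≤ r) := by omega
  have htot : c1 + c2 + c3 + c4 + s + s' + e1 + e2 + e3 + e4 ≤ 2 * K + 2 * L + 2 := by omega
  generalize c1 + c2 + c3 + c4 + s + s' = c at *
  clear h1 p1 q1 h2 p2 q2 h3 p3 q3 h4 p4 q4 he1 he2 he3 he4 hs hs'
  omega

theorem pinwheel_count_le_two_two_of_top_missed
    {K L x u y w r c2 a2 b2 c3 a3 b3 c4 a4 b4 s s' : ℕ} (hK : 1 ≤ K) (hx : x + u + 1 = 4 * L + 2)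
    (hy : y + w + 1 = 4 * K + 2) (h1 : r < x + 5) (h2 : WindowBound L x w r c2 a2 b2)
    (h3 : WindowBound K w u r c3 a3 b3) (h4 : WindowBound L u y r c4 a4 b4)
    (hs : s = 0 ∨ s = 1 ∧ x + w ≤ r + 3 ∧ x + 2 ≤ r + 1 + w ∧ 1 + w ≤ x + r + 2 ∧
      3 ≤ x + w + r)
    (hs' : s' = 0 ∨ s' = 1 ∧ u + y ≤ r + 3 ∧ u + 2 ≤ r + 1 + y ∧ 1 + y ≤ u + r + 2 ∧
      3 ≤ u + y + r) :
    c2 + c3 + c4 + s + s' ≤ r := by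
  obtain ⟨h2, p2, q2⟩ := h2
  obtain ⟨h3, p3, q3⟩ := h3
  obtain ⟨h4, p4, q4⟩ := h4
  obtain ⟨e1, he1⟩ : ∃ e, e = b4 := ⟨_, rfl⟩
  have k1 : x + y ≤ 4 * e1 + 5 + r := by omega
  obtain ⟨e2, he2⟩ : ∃ e, e = a2 := ⟨_, rfl⟩
  have k2 : x + w ≤ 4 * e2 + r := by omega
  obtain ⟨e3, he3⟩ : ∃ e, e = a3 + b2 := ⟨_, rfl⟩
  have k3 : u + w ≤ 2 * e3 + 2 + r ∧ (e3 = 0 → u + w ≤ r) := by omega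
  obtain ⟨e4, he4⟩ : ∃ e, e = a4 + b3 := ⟨_, rfl⟩
  have k4 : u + y ≤ 2 * e4 + 2 + r ∧ (e4 = 0 → u + y ≤ r) := by omega
  have htot : c2 + c3 + c4 + e1 + e2 + e3 + e4 ≤ L + K + L := by omega
  generalize c2 + c3 + c4 = c at *
  clear h2 p2 q2 h3 p3 q3 h4 p4 q4 he1 he2 he3 he4
  rcases hs with rfl | ⟨rfl, hs⟩ <;> rcases hs' with rfl | ⟨rfl, hs'⟩
  · omega
  · omega
  · omega
  -- With both extra points in the ball, adding the two bounds yields `2 * K + 2 * L ≤ r + 2`.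
  · replace hs := hs.1
    replace hs' := hs'.1
    omega

theorem pinwheel_count_le_two_two_of_right_missed
    {K L x u y w r c1 a1 b1 c3 a3 b3 c4 a4 b4 s s' : ℕ} (hL : 1 ≤ L) (hx : x + u + 1 = 4 * L + 2)
    (hy : y + w + 1 = 4 * K + 2) (h1 : WindowBound K y x r c1 a1 b1) (h2 : r < w + 5)
    (h3 : WindowBound K w u r c3 a3 b3) (h4 : WindowBound L u y r c4 a4 b4)
    (hs : s = 0 ∨ s = 1 ∧ x + w ≤ r + 3 ∧ x + 2 ≤ r + 1 + w ∧ 1 + w ≤ x + r + 2 ∧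
      3 ≤ x + w + r)
    (hs' : s' = 0 ∨ s' = 1 ∧ u + y ≤ r + 3 ∧ u + 2 ≤ r + 1 + y ∧ 1 + y ≤ u + r + 2 ∧
      3 ≤ u + y + r) :
    c1 + c3 + c4 + s + s' ≤ r := by
  obtain ⟨h1, p1, q1⟩ := h1
  obtain ⟨h3, p3, q3⟩ := h3
  obtain ⟨h4, p4, q4⟩ := h4
  obtain ⟨e1, he1⟩ : ∃ e, e = a1 + b4 := ⟨_, rfl⟩
  have k1 : x + y ≤ 2 * e1 + 2 + r ∧ (e1 = 0 → x + y ≤ r) := by omega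
  obtain ⟨e2, he2⟩ : ∃ e, e = b1 := ⟨_, rfl⟩
  have k2 : x + w ≤ 4 * e2 + 5 + r := by omega
  obtain ⟨e3, he3⟩ : ∃ e, e = a3 := ⟨_, rfl⟩
  have k3 : u + w ≤ 4 * e3 + r := by omega
  obtain ⟨e4, he4⟩ : ∃ e, e = a4 + b3 := ⟨_, rfl⟩
  have k4 : u + y ≤ 2 * e4 + 2 + r ∧ (e4 = 0 → u + y ≤ r) := by omega
  have htot : c1 + c3 + c4 + e1 + e2 + e3 + e4 ≤ K + K + L := by omega
  generalize c1 + c3 + c4 = c at *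
  clear h1 p1 q1 h3 p3 q3 h4 p4 q4 he1 he2 he3 he4
  rcases hs with rfl | ⟨rfl, hs⟩ <;> rcases hs' with rfl | ⟨rfl, hs'⟩
  · omega
  · omega
  · omega
  · omega

theorem pinwheel_count_le_two_two_of_top_right_missed {K L x u y w r c3 a3 b3 c4 a4 b4 s s' : ℕ}
    (hL : 1 ≤ L) (hK : 1 ≤ K) (hx : x + u + 1 = 4 * L + 2) (hy : y + w + 1 = 4 * K + 2)
    (hr : 1 ≤ r) (h2 : r < w + 5) (h3 : WindowBound K w u r c3 a3 b3)
    (h4 : WindowBound L u y r c4 a4 b4)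
    (hs : s = 0 ∨ s = 1 ∧ x + w ≤ r + 3 ∧ x + 2 ≤ r + 1 + w ∧ 1 + w ≤ x + r + 2 ∧
      3 ≤ x + w + r)
    (hs' : s' = 0 ∨ s' = 1 ∧ u + y ≤ r + 3 ∧ u + 2 ≤ r + 1 + y ∧ 1 + y ≤ u + r + 2 ∧
      3 ≤ u + y + r) :
    c3 + c4 + s + s' ≤ r := by
  obtain ⟨h3, p3, q3⟩ := h3
  obtain ⟨h4, p4, q4⟩ := h4
  obtain ⟨e1, he1⟩ : ∃ e, e = b4 := ⟨_, rfl⟩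
  have k1 : x + y ≤ 4 * e1 + 5 + r := by omega
  obtain ⟨e3, he3⟩ : ∃ e, e = a3 := ⟨_, rfl⟩
  have k3 : u + w ≤ 4 * e3 + r := by omega
  obtain ⟨e4, he4⟩ : ∃ e, e = a4 + b3 := ⟨_, rfl⟩
  have k4 : u + y ≤ 2 * e4 + 2 + r ∧ (e4 = 0 → u + y ≤ r) := by omega
  have htot : c3 + c4 + e1 + e3 + e4 ≤ K + L := by omega
  generalize c3 + c4 = c at *
  clear h3 p3 q3 h4 p4 q4 he1 he3 he4
  rcases hs with rfl | ⟨rfl, hs⟩ <;> rcases hs' with rfl | ⟨rfl, hs'⟩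
  · omega
  · omega
  · omega
  · replace hs := hs.1
    replace hs' := hs'.1
    omega

theorem pinwheel_count_le_two_two_of_top_bottom_missed {K L x u y w r c2 a2 b2 c4 a4 b4 s s' : ℕ}
    (hK : 1 ≤ K) (hx : x + u + 1 = 4 * L + 2) (hy : y + w + 1 = 4 * K + 2) (h1 : r < x + 5)
    (h2 : WindowBound L x w r c2 a2 b2) (h3 : r < u + 5) (h4 : WindowBound L u y r c4 a4 b4)
    (hs : s = 0 ∨ s = 1 ∧ x + w ≤ r + 3 ∧ x + 2 ≤ r + 1 + w ∧ 1 + w ≤ x + r + 2 ∧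
      3 ≤ x + w + r)
    (hs' : s' = 0 ∨ s' = 1 ∧ u + y ≤ r + 3 ∧ u + 2 ≤ r + 1 + y ∧ 1 + y ≤ u + r + 2 ∧
      3 ≤ u + y + r) :
    c2 + c4 + s + s' ≤ r := by
  obtain ⟨h2, p2, q2⟩ := h2
  obtain ⟨h4, p4, q4⟩ := h4
  obtain ⟨e1, he1⟩ : ∃ e, e = b4 := ⟨_, rfl⟩
  have k1 : x + y ≤ 4 * e1 + 5 + r := by omega
  obtain ⟨e2, he2⟩ : ∃ e, e = a2 := ⟨_, rfl⟩
  have k2 : x + w ≤ 4 * e2 + r := by omega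
  obtain ⟨e3, he3⟩ : ∃ e, e = b2 := ⟨_, rfl⟩
  have k3 : u + w ≤ 4 * e3 + 5 + r := by omega
  obtain ⟨e4, he4⟩ : ∃ e, e = a4 := ⟨_, rfl⟩
  have k4 : u + y ≤ 4 * e4 + r := by omega
  have htot : c2 + c4 + e1 + e2 + e3 + e4 ≤ L + L := by omega
  generalize c2 + c4 = c at *
  clear h2 p2 q2 h4 p4 q4 he1 he2 he3 he4
  rcases hs with rfl | ⟨rfl, hs⟩ <;> rcases hs' with rfl | ⟨rfl, hs'⟩
  · omega
  · omega
  · omega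
  · omega

theorem pinwheel_count_le_two_two_of_right_bottom_missed
    {K L x u y w r c1 a1 b1 c4 a4 b4 s s' : ℕ} (hL : 1 ≤ L) (hx : x + u + 1 = 4 * L + 2)
    (hy : y + w + 1 = 4 * K + 2) (hr : 1 ≤ r) (h1 : WindowBound K y x r c1 a1 b1)
    (h4 : WindowBound L u y r c4 a4 b4)
    (hs : s = 0 ∨ s = 1 ∧ x + w ≤ r + 3 ∧ x + 2 ≤ r + 1 + w ∧ 1 + w ≤ x + r + 2 ∧
      3 ≤ x + w + r)
    (hs' : s' = 0 ∨ s' = 1 ∧ u + y ≤ r + 3 ∧ u + 2 ≤ r + 1 + y ∧ 1 + y ≤ u + r + 2 ∧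
      3 ≤ u + y + r) :
    c1 + c4 + s + s' ≤ r := by
  obtain ⟨h1, p1, q1⟩ := h1
  obtain ⟨h4, p4, q4⟩ := h4
  obtain ⟨e1, he1⟩ : ∃ e, e = a1 + b4 := ⟨_, rfl⟩
  have k1 : x + y ≤ 2 * e1 + 2 + r ∧ (e1 = 0 → x + y ≤ r) := by omega
  obtain ⟨e2, he2⟩ : ∃ e, e = b1 := ⟨_, rfl⟩
  have k2 : x + w ≤ 4 * e2 + 5 + r := by omega
  obtain ⟨e4, he4⟩ : ∃ e, e = a4 := ⟨_, rfl⟩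
  have k4 : u + y ≤ 4 * e4 + r := by omega
  have htot : c1 + c4 + e1 + e2 + e4 ≤ K + L := by omega
  generalize c1 + c4 = c at *
  clear h1 p1 q1 h4 p4 q4 he1 he2 he4
  rcases hs with rfl | ⟨rfl, hs⟩ <;> rcases hs' with rfl | ⟨rfl, hs'⟩
  · omega
  · omega
  · omega
  · omega

theorem pinwheel_count_le_two_two_of_right_left_missed {K L x u y w r c1 a1 b1 c3 a3 b3 s s' : ℕ}
    (hL : 1 ≤ L) (hx : x + u + 1 = 4 * L + 2) (hy : y + w + 1 = 4 * K + 2)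
    (h1 : WindowBound K y x r c1 a1 b1) (h2 : r < w + 5) (h3 : WindowBound K w u r c3 a3 b3)
    (h4 : r < y + 5)
    (hs : s = 0 ∨ s = 1 ∧ x + w ≤ r + 3 ∧ x + 2 ≤ r + 1 + w ∧ 1 + w ≤ x + r + 2 ∧
      3 ≤ x + w + r)
    (hs' : s' = 0 ∨ s' = 1 ∧ u + y ≤ r + 3 ∧ u + 2 ≤ r + 1 + y ∧ 1 + y ≤ u + r + 2 ∧
      3 ≤ u + y + r) :
    c1 + c3 + s + s' ≤ r := by
  obtain ⟨h1, p1, q1⟩ := h1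
  obtain ⟨h3, p3, q3⟩ := h3
  obtain ⟨e1, he1⟩ : ∃ e, e = a1 := ⟨_, rfl⟩
  have k1 : x + y ≤ 4 * e1 + r := by omega
  obtain ⟨e2, he2⟩ : ∃ e, e = b1 := ⟨_, rfl⟩
  have k2 : x + w ≤ 4 * e2 + 5 + r := by omega
  obtain ⟨e3, he3⟩ : ∃ e, e = a3 := ⟨_, rfl⟩
  have k3 : u + w ≤ 4 * e3 + r := by omega
  obtain ⟨e4, he4⟩ : ∃ e, e = b3 := ⟨_, rfl⟩
  have k4 : u + y ≤ 4 * e4 + 5 + r := by omega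
  have htot : c1 + c3 + e1 + e2 + e3 + e4 ≤ K + K := by omega
  generalize c1 + c3 = c at *
  clear h1 p1 q1 h3 p3 q3 he1 he2 he3 he4
  rcases hs with rfl | ⟨rfl, hs⟩ <;> rcases hs' with rfl | ⟨rfl, hs'⟩
  · omega
  · omega
  · omega
  · replace hs := hs.1
    replace hs' := hs'.1
    omega

/-- The count for the pinwheel with two more points, when `n % 4 = 2` and `m % 4 = 2`. -/
theorem pinwheel_count_le_two_two {K L x u y w r c1 c2 c3 c4 s s' : ℕ}
    (hK : 1 ≤ K) (hL : 1 ≤ L)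
    (hx : x + u + 1 = 4 * L + 2) (hy : y + w + 1 = 4 * K + 2) (hr : 1 ≤ r)
    (h1 : (c1 = 0 ∧ r < x + 5) ∨ ∃ a b, WindowBound K y x r c1 a b)
    (h2 : (c2 = 0 ∧ r < w + 5) ∨ ∃ a b, WindowBound L x w r c2 a b)
    (h3 : (c3 = 0 ∧ r < u + 5) ∨ ∃ a b, WindowBound K w u r c3 a b)
    (h4 : (c4 = 0 ∧ r < y + 5) ∨ ∃ a b, WindowBound L u y r c4 a b)
    (hs : s = 0 ∨ s = 1 ∧ x + w ≤ r + 3 ∧ x + 2 ≤ r + 1 + w ∧ 1 + w ≤ x + r + 2 ∧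
      3 ≤ x + w + r)
    (hs' : s' = 0 ∨ s' = 1 ∧ u + y ≤ r + 3 ∧ u + 2 ≤ r + 1 + y ∧ 1 + y ≤ u + r + 2 ∧
      3 ≤ u + y + r) :
    c1 + c2 + c3 + c4 + s + s' ≤ r := by
  rcases h1 with ⟨rfl, h1⟩ | ⟨a1, b1, h1⟩ <;> rcases h2 with ⟨rfl, h2⟩ | ⟨a2, b2, h2⟩ <;>
    rcases h3 with ⟨rfl, h3⟩ | ⟨a3, b3, h3⟩ <;> rcases h4 with ⟨rfl, h4⟩ | ⟨a4, b4, h4⟩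
  · omega
  · obtain ⟨h4, p4, q4⟩ := h4
    omega
  · obtain ⟨h3, p3, q3⟩ := h3
    omega
  · have := pinwheel_count_le_two_two_of_top_right_missed hL hK hx hy hr h2 h3 h4 hs hs'
    omega
  · obtain ⟨h2, p2, q2⟩ := h2
    omega
  · have := pinwheel_count_le_two_two_of_top_bottom_missed hK hx hy h1 h2 h3 h4 hs hs'
    omega
  -- Rotation by 180° exchanges opposite sides and the two extra points, which settles this case and
  -- the later ones with `x := u`.
  · have := pinwheel_count_le_two_two_of_right_bottom_missed (x := u) (u := x) (y := w) (w := y)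
      hL (by omega) (by omega) hr h3 h2 hs' hs
    omega
  · have := pinwheel_count_le_two_two_of_top_missed hK hx hy h1 h2 h3 h4 hs hs'
    omega
  · obtain ⟨h1, p1, q1⟩ := h1
    omega
  · have := pinwheel_count_le_two_two_of_right_bottom_missed hL hx hy hr h1 h4 hs hs'
    omega
  · have := pinwheel_count_le_two_two_of_right_left_missed hL hx hy h1 h2 h3 h4 hs hs'
    omega
  · have := pinwheel_count_le_two_two_of_right_missed hL hx hy h1 h2 h3 h4 hs hs'
    omega
  · have := pinwheel_count_le_two_two_of_top_right_missed (x := u) (u := x) (y := w) (w := y)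
      hL hK (by omega) (by omega) hr h4 h1 h2 hs' hs
    omega
  · have := pinwheel_count_le_two_two_of_top_missed (x := u) (u := x) (y := w) (w := y)
      hK (by omega) (by omega) h3 h4 h1 h2 hs' hs
    omega
  · have := pinwheel_count_le_two_two_of_right_missed (x := u) (u := x) (y := w) (w := y)
      hL (by omega) (by omega) h3 h4 h1 h2 hs' hs
    omega
  · exact pinwheel_count_le_two_two_of_all_met hx hy h1 h2 h3 h4 hs hs'

/-! ### Counting for grids with a side of length 4 -/

/-- This serves `isPackingList_four`: the windows belong to its two runs in steps of 4, and `s₁`,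
..., `s₄` to its four single points. As `x` has only four values, the count is a finite case check.
-/
theorem count_le_four {k x u y w r c₁ c₂ s₁ s₂ s₃ s₄ : ℕ} (hx : x + u = 3)
    (hy : y + w = 4 * k + 5) (hr : 1 ≤ r)
    (h₁ : c₁ = 0 ∨ ∃ a b, WindowBound k y x r c₁ a b)
    (h₂ : c₂ = 0 ∨ ∃ a b, WindowBound (k + 1) y u r c₂ a b)
    (hs₁ : s₁ = 0 ∨ s₁ = 1 ∧ x + w ≤ r)
    (hs₂ : s₂ = 0 ∨ s₂ = 1 ∧ x + w ≤ r + 3 ∧ x + 3 ≤ r + w)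
    (hs₃ : s₃ = 0 ∨ s₃ = 1 ∧ x + w ≤ r + 6 ∧ x + 6 ≤ r + w)
    (hs₄ : s₄ = 0 ∨ s₄ = 1 ∧ u + w ≤ r) :
    c₁ + c₂ + s₁ + s₂ + s₃ + s₄ ≤ r := by
  obtain ⟨rfl, rfl⟩ | ⟨rfl, rfl⟩ | ⟨rfl, rfl⟩ | ⟨rfl, rfl⟩ :
      (x = 0 ∧ u = 3) ∨ (x = 1 ∧ u = 2) ∨ (x = 2 ∧ u = 1) ∨ (x = 3 ∧ u = 0) := by omega
  all_goals
    rcases h₁ with rfl | ⟨a₁, b₁, h₁, p₁, q₁⟩ <;> rcases h₂ with rfl | ⟨a₂, b₂, h₂, p₂, q₂⟩ <;>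
    rcases hs₁ with rfl | ⟨rfl, hs₁⟩ <;> rcases hs₂ with rfl | ⟨rfl, hs₂⟩ <;>
    rcases hs₃ with rfl | ⟨rfl, hs₃⟩ <;> rcases hs₄ with rfl | ⟨rfl, hs₄⟩ <;> omega

/-! ### The explicit multipackings -/

/-- Points along the boundary, at distance `4` from each other on each side, starting at the
four corners. -/
def pinwheel (n m : ℕ) : List (ℕ × ℕ) :=
  (List.range (m / 4)).map (fun t => (0, 4 * t)) ++
    (List.range (n / 4)).map (fun t => (4 * t, m - 1)) ++
    (List.range (m / 4)).map (fun t => (n - 1, m - 1 - 4 * t)) ++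
    (List.range (n / 4)).map (fun t => (n - 1 - 4 * t, 0))

theorem length_pinwheel (n m : ℕ) : (pinwheel n m).length = 2 * (n / 4) + 2 * (m / 4) := by
  simp [pinwheel]
  omega

theorem mem_pinwheel {n m : ℕ} (hn : 4 ≤ n) (hm : 4 ≤ m) {p : ℕ × ℕ} (hp : p ∈ pinwheel n m) :
    p.1 < n ∧ p.2 < m := by
  simp only [pinwheel, List.mem_append, List.mem_map, List.mem_range] at hp
  obtain ((⟨t, ht, rfl⟩ | ⟨t, ht, rfl⟩) | ⟨t, ht, rfl⟩) | ⟨t, ht, rfl⟩ := hp <;>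
  constructor <;> dsimp only <;> omega

theorem exists_windowBound_or {K z d r g : ℕ} (hK : 1 ≤ K) (hg : 3 ≤ g)
    (hz : z + 4 ≤ 4 * K + g) :
    let c := (List.range K).countP (fun t => Nat.dist (4 * t) z + d ≤ r)
    (c = 0 ∧ r < d + g) ∨ ∃ a b, WindowBound K z d r c a b := by
  intro c
  by_cases h : c = 0
  · exact Or.inl ⟨h, lt_add_of_countP_range_eq_zero hK hg hz h⟩
  · exact Or.inr (exists_windowBound K z d r h)

/-- Measuring the centre from the corner where each side starts turns all four sides into the same
progression. -/
theorem countP_taxicab_pinwheel {n m x y : ℕ} (hx : x < n) (hy : y < m) (r : ℕ) :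
    (pinwheel n m).countP (fun p => taxicab p (x, y) ≤ r) =
      (List.range (m / 4)).countP (fun t => Nat.dist (4 * t) y + x ≤ r) +
      (List.range (n / 4)).countP (fun t => Nat.dist (4 * t) x + (m - 1 - y) ≤ r) +
      (List.range (m / 4)).countP (fun t => Nat.dist (4 * t) (m - 1 - y) + (n - 1 - x) ≤ r) +
      (List.range (n / 4)).countP (fun t => Nat.dist (4 * t) (n - 1 - x) + y ≤ r) := by
  simp only [pinwheel, List.countP_append, List.countP_map]
  congr 1
  · congr 1
    · congr 1
      all_goals
        refine List.countP_congr fun t ht => ?_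
        rw [List.mem_range] at ht
        rw [Function.comp_apply, decide_eq_true_iff, decide_eq_true_iff]
        simp only [taxicab, Nat.dist]
        omega
    · refine List.countP_congr fun t ht => ?_
      rw [List.mem_range] at ht
      rw [Function.comp_apply, decide_eq_true_iff, decide_eq_true_iff]
      simp only [taxicab, Nat.dist]
      omega
  · refine List.countP_congr fun t ht => ?_
    rw [List.mem_range] at ht
    rw [Function.comp_apply, decide_eq_true_iff, decide_eq_true_iff]
    simp only [taxicab, Nat.dist]
    omega

theorem isPackingList_pinwheel {n m : ℕ} (hn : 4 ≤ n) (hm : 4 ≤ m) (hn4 : n % 4 = 0)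
    (hm4 : m % 4 = 0) : IsPackingList n m (pinwheel n m) := by
  refine ⟨fun p hp => mem_pinwheel hn hm hp, fun x y r hx hy hr => ?_⟩
  rw [countP_taxicab_pinwheel hx hy]
  apply pinwheel_count_le_zero_zero (K := m / 4) (L := n / 4) (x := x) (y := y) (u := n - 1 - x)
    (w := m - 1 - y)
  any_goals apply exists_windowBound_or
  all_goals omega

theorem countP_singleton_eq {α : Type*} (p : α → Bool) (a : α) :
    [a].countP p = 0 ∨ [a].countP p = 1 ∧ p a = true := by
  by_cases h : p a = true <;> simp [h]

theorem isPackingList_pinwheel_append_one {n m : ℕ} (hn : 8 ≤ n) (hm : 6 ≤ m) (hn4 : n % 4 = 0)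
    (hm4 : m % 4 = 2) : IsPackingList n m (pinwheel n m ++ [(1, m - 3)]) := by
  refine ⟨fun p hp => ?_, fun x y r hx hy hr => ?_⟩
  · rw [List.mem_append, List.mem_singleton] at hp
    obtain hp | rfl := hp
    · exact mem_pinwheel (by omega) (by omega) hp
    · constructor <;> dsimp only <;> omega
  rw [List.countP_append, countP_taxicab_pinwheel hx hy]
  apply pinwheel_count_le_zero_two (K := m / 4) (L := n / 4) (x := x) (y := y) (u := n - 1 - x)
    (w := m - 1 - y)
  case hs =>
    refine (countP_singleton_eq _ _).imp_right fun h => ⟨h.1, ?_⟩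
    have := of_decide_eq_true h.2
    simp only [taxicab, Nat.dist] at this
    omega
  any_goals apply exists_windowBound_or
  all_goals omega

theorem isPackingList_pinwheel_append_two {n m : ℕ} (hn : 6 ≤ n) (hm : 6 ≤ m) (hn4 : n % 4 = 2)
    (hm4 : m % 4 = 2) :
    IsPackingList n m (pinwheel n m ++ [(1, m - 3)] ++ [(n - 2, 2)]) := by
  refine ⟨fun p hp => ?_, fun x y r hx hy hr => ?_⟩
  · rw [List.mem_append, List.mem_append, List.mem_singleton, List.mem_singleton] at hp
    obtain (hp | rfl) | rfl := hp
    · exact mem_pinwheel (by omega) (by omega) hp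
    all_goals constructor <;> dsimp only <;> omega
  rw [List.countP_append, List.countP_append, countP_taxicab_pinwheel hx hy]
  apply pinwheel_count_le_two_two (K := m / 4) (L := n / 4) (x := x) (y := y) (u := n - 1 - x)
    (w := m - 1 - y)
  case hs =>
    refine (countP_singleton_eq _ _).imp_right fun h => ⟨h.1, ?_⟩
    have := of_decide_eq_true h.2
    simp only [taxicab, Nat.dist] at this
    omega
  case hs' =>
    refine (countP_singleton_eq _ _).imp_right fun h => ⟨h.1, ?_⟩
    have := of_decide_eq_true h.2
    simp only [taxicab, Nat.dist] at this
    omega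
  any_goals apply exists_windowBound_or
  all_goals omega

/-- For `m ≥ 10` the pinwheel with `(1, m - 3)` fails here: the ball of radius 4 around that point
contains five points. Instead, the top row ends with steps of 3 and the bottom row with a step of 5.
-/
theorem isPackingList_four {k : ℕ} (hk : 1 ≤ k) : IsPackingList 4 (4 * k + 6)
    ((List.range k).map (fun t => (0, 4 * t)) ++ (List.range (k + 1)).map (fun t => (3, 4 * t)) ++
      [(0, 4 * k + 5)] ++ [(0, 4 * k + 2)] ++ [(0, 4 * k - 1)] ++ [(3, 4 * k + 5)]) := by
  refine ⟨fun p hp => ?_, fun x y r hx hy hr => ?_⟩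
  · simp only [List.mem_append, List.mem_map, List.mem_range, List.mem_singleton] at hp
    obtain ((((⟨t, ht, rfl⟩ | ⟨t, ht, rfl⟩) | rfl) | rfl) | rfl) | rfl := hp <;>
    constructor <;> dsimp only <;> omega
  simp only [List.countP_append, List.countP_map]
  have h₁ : (List.range k).countP ((fun p => decide (taxicab p (x, y) ≤ r)) ∘ fun t => (0, 4 * t))
      = (List.range k).countP (fun t => Nat.dist (4 * t) y + x ≤ r) := by
    refine List.countP_congr fun t ht => ?_
    rw [Function.comp_apply, decide_eq_true_iff, decide_eq_true_iff]
    simp only [taxicab, Nat.dist]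
    omega
  have h₂ : (List.range (k + 1)).countP
        ((fun p => decide (taxicab p (x, y) ≤ r)) ∘ fun t => (3, 4 * t))
      = (List.range (k + 1)).countP (fun t => Nat.dist (4 * t) y + (3 - x) ≤ r) := by
    refine List.countP_congr fun t ht => ?_
    rw [Function.comp_apply, decide_eq_true_iff, decide_eq_true_iff]
    simp only [taxicab, Nat.dist]
    omega
  rw [h₁, h₂]
  have hs (p : ℕ × ℕ) : ([p].countP fun p => decide (taxicab p (x, y) ≤ r)) = 0 ∨
      ([p].countP fun p => decide (taxicab p (x, y) ≤ r)) = 1 ∧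
        p.1 - x + (x - p.1) + (p.2 - y + (y - p.2)) ≤ r :=
    (countP_singleton_eq _ _).imp_right fun h => ⟨h.1, of_decide_eq_true h.2⟩
  apply count_le_four (k := k) (x := x) (y := y) (u := 3 - x) (w := 4 * k + 5 - y) (by omega)
    (by omega) hr
  · exact or_iff_not_imp_left.2 (exists_windowBound _ _ _ _)
  · exact or_iff_not_imp_left.2 (exists_windowBound _ _ _ _)
  · exact (hs _).imp_right fun h => ⟨h.1, by have := h.2; dsimp only at this; omega⟩
  · exact (hs _).imp_right fun h => ⟨h.1, by have := h.2; dsimp only at this; omega⟩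
  · exact (hs _).imp_right fun h => ⟨h.1, by have := h.2; dsimp only at this; omega⟩
  · exact (hs _).imp_right fun h => ⟨h.1, by have := h.2; dsimp only at this; omega⟩

/-! ### Choosing a multipacking for each size -/

theorem exists_isPackingList_of_even {n m : ℕ} (hn : 4 ≤ n) (hm : 4 ≤ m) (hn2 : n % 2 = 0)
    (hm2 : m % 2 = 0) (h46 : ¬(n = 4 ∧ m = 6)) (h64 : ¬(n = 6 ∧ m = 4)) :
    ∃ l, IsPackingList n m l ∧ l.length = n / 2 + m / 2 := by
  have mixed {n m : ℕ} (hn : 4 ≤ n) (hm : 4 ≤ m) (hn4 : n % 4 = 0) (hm4 : m % 4 = 2)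
      (h46 : ¬(n = 4 ∧ m = 6)) : ∃ l, IsPackingList n m l ∧ l.length = n / 2 + m / 2 := by
    by_cases h8 : 8 ≤ n
    · refine ⟨_, isPackingList_pinwheel_append_one h8 (by omega) hn4 hm4, ?_⟩
      rw [List.length_append, length_pinwheel, List.length_singleton]
      omega
    · obtain rfl : n = 4 := by omega
      obtain ⟨k, hk, rfl⟩ : ∃ k, 1 ≤ k ∧ m = 4 * k + 6 := ⟨(m - 6) / 4, by omega, by omega⟩
      refine ⟨_, isPackingList_four hk, ?_⟩
      simp only [List.length_append, List.length_map, List.length_range, List.length_singleton]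
      omega
  obtain hn4 | hn4 : n % 4 = 0 ∨ n % 4 = 2 := by omega
  all_goals obtain hm4 | hm4 : m % 4 = 0 ∨ m % 4 = 2 := by omega
  · refine ⟨_, isPackingList_pinwheel hn hm hn4 hm4, ?_⟩
    rw [length_pinwheel]
    omega
  · exact mixed hn hm hn4 hm4 h46
  · obtain ⟨l, hl, hlen⟩ := mixed hm hn hm4 hn4 fun h => h64 h.symm
    exact ⟨_, hl.swap, by rw [List.length_map, hlen, add_comm]⟩
  · refine ⟨_, isPackingList_pinwheel_append_two (by omega) (by omega) hn4 hm4, ?_⟩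
    simp only [List.length_append, length_pinwheel, List.length_singleton]
    omega

theorem isPackingList_four_seven :
    IsPackingList 4 7 [(0, 0), (0, 3), (0, 6), (3, 0), (3, 4)] := by
  refine ⟨by decide, fun x y r hx hy hr => ?_⟩
  by_cases h : r < 5
  · have : ∀ x < 4, ∀ y < 7, ∀ r < 5, 0 < r →
        [(0, 0), (0, 3), (0, 6), (3, 0), (3, 4)].countP (fun p => taxicab p (x, y) ≤ r) ≤ r := by
      decide +kernel
    exact this x hx y hy r h hr
  · exact List.countP_le_length.trans (not_lt.1 h)

theorem isPackingList_five_six :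
    IsPackingList 5 6 [(0, 0), (0, 3), (1, 5), (3, 0), (4, 5)] := by
  refine ⟨by decide, fun x y r hx hy hr => ?_⟩
  by_cases h : r < 5
  · have : ∀ x < 5, ∀ y < 6, ∀ r < 5, 0 < r →
        [(0, 0), (0, 3), (1, 5), (3, 0), (4, 5)].countP (fun p => taxicab p (x, y) ≤ r) ≤ r := by
      decide +kernel
    exact this x hx y hy r h hr
  · exact List.countP_le_length.trans (not_lt.1 h)

theorem exists_isPackingList {n m : ℕ} (hn : 4 ≤ n) (hm : 4 ≤ m) (h46 : ¬(n = 4 ∧ m = 6))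
    (h64 : ¬(n = 6 ∧ m = 4)) : ∃ l, IsPackingList n m l ∧ l.length = n / 2 + m / 2 := by
  -- These are the sizes whose even parts would be the exceptional grid 4 × 6.
  have small {n m : ℕ} (hn : n / 2 = 2) (hm : m / 2 = 3) (h46 : ¬(n = 4 ∧ m = 6)) :
      ∃ l, IsPackingList n m l ∧ l.length = n / 2 + m / 2 := by
    by_cases h7 : m = 7
    · exact ⟨_, isPackingList_four_seven.mono (by omega) (by omega) (by omega) h7.ge,
        by rw [hn, hm]; rfl⟩
    · exact ⟨_, isPackingList_five_six.mono (by omega) (by omega) (by omega) (by omega),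
        by rw [hn, hm]; rfl⟩
  by_cases h₁ : n / 2 = 2 ∧ m / 2 = 3
  · exact small h₁.1 h₁.2 h46
  by_cases h₂ : n / 2 = 3 ∧ m / 2 = 2
  · obtain ⟨l, hl, hlen⟩ := small h₂.2 h₂.1 fun h => h64 h.symm
    exact ⟨_, hl.swap, by rw [List.length_map, hlen, add_comm]⟩
  · obtain ⟨l, hl, hlen⟩ := exists_isPackingList_of_even (n := 2 * (n / 2)) (m := 2 * (m / 2))
      (by omega) (by omega) (by omega) (by omega) (by omega) (by omega)
    exact ⟨l, hl.mono (by omega) (by omega) (by omega) (by omega), by omega⟩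

/-! ### The exceptional grid 4 × 6 -/

/-- Twice the weights of a fractional multipacking of the grid `P_4 □ P_6` of total weight `9 / 2`. -/
def fourSixWeight (p : Fin 4 × Fin 6) : ℕ :=
  ![![2, 0, 0, 1, 0, 1], ![0, 0, 1, 0, 0, 1], ![0, 0, 0, 0, 0, 0], ![1, 1, 0, 0, 0, 1]] p.1 p.2

theorem sum_fourSixWeight : ∑ p, fourSixWeight p = 9 := by
  decide +kernel

theorem sum_fourSixWeight_le (v : Fin 4 × Fin 6) (r : ℕ) (hr : 0 < r) :
    ∑ u with taxicab (gridCoord u) (gridCoord v) ≤ r, fourSixWeight u ≤ 2 * r := by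
  -- From radius 5 on, the total weight 9 is already below `2 * r`.
  by_cases h : r < 5
  · have : ∀ v : Fin 4 × Fin 6, ∀ r < 5, 0 < r →
        ∑ u with taxicab (gridCoord u) (gridCoord v) ≤ r, fourSixWeight u ≤ 2 * r := by
      decide +kernel
    exact this v r h hr
  · calc _ ≤ ∑ p, fourSixWeight p := Finset.sum_le_sum_of_subset (Finset.filter_subset _ _)
      _ ≤ 2 * r := by rw [sum_fourSixWeight]; omega

theorem broadcastNumber_gridGraph_four_six : (gridGraph 4 6).broadcastNumber = 5 := by
  refine le_antisymm (broadcastNumber_gridGraph_le (by norm_num) (by norm_num)) ?_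
  obtain ⟨f, hf, hfc⟩ := (gridGraph 4 6).isLeast_broadcastNumber.1
  have := hf.sum_le_mul_cost fourSixWeight 2
    (fun v r => Finset.univ.filter fun u => taxicab (gridCoord u) (gridCoord v) ≤ r)
    (fun u v r h => by simpa [mem_closedBall_gridGraph] using h) sum_fourSixWeight_le
  rw [sum_fourSixWeight, hfc] at this
  omega

theorem SimpleGraph.IsMultipacking.card_filter_taxicab_le {n m : ℕ} {M : Finset (Fin n × Fin m)}
    (hM : (gridGraph n m).IsMultipacking M) (v : Fin n × Fin m) {r : ℕ} (hr : 0 < r) :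
    (M.filter fun u => taxicab (gridCoord u) (gridCoord v) ≤ r).card ≤ r := by
  refine le_trans (le_of_eq ?_) (hM v r hr)
  congr 1
  ext u
  simp [mem_closedBall_gridGraph]

/-- The corners of the grid `P_4 □ P_6`. -/
def fourSixCorners : Finset (Fin 4 × Fin 6) := {(0, 0), (0, 5), (3, 0), (3, 5)}

theorem multipackingNumber_gridGraph_four_six : (gridGraph 4 6).multipackingNumber = 4 := by
  apply le_antisymm
  · obtain ⟨M', hM', hMc'⟩ := (gridGraph 4 6).isGreatest_multipackingNumber.1
    rw [← hMc']
    by_contra! hlt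
    obtain ⟨M, hMM, hMc⟩ := Finset.exists_subset_card_eq (Nat.succ_le_of_lt hlt)
    have hM := hM'.subset hMM
    have hcorner : fourSixCorners ⊆ M := by
      intro c hc
      by_contra hcM
      -- A ball of radius 4 covers everything except possibly `c`, so it would contain all five
      -- points of `M`.
      have hball : ∀ c ∈ fourSixCorners, ∃ v : Fin 4 × Fin 6, ∀ u, u ≠ c →
          taxicab (gridCoord u) (gridCoord v) ≤ 4 := by
        decide +kernel
      obtain ⟨v, hv⟩ := hball c hc
      have := hM.card_filter_taxicab_le v (r := 4) (by norm_num)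
      rw [Finset.filter_true_of_mem fun u hu => hv u (ne_of_mem_of_not_mem hu hcM)] at this
      omega
    obtain ⟨p, hpM, hp⟩ : ∃ p ∈ M, p ∉ fourSixCorners :=
      Finset.exists_mem_notMem_of_card_lt_card (by rw [hMc]; decide)
    -- Together with the corners, any fifth point overcrowds a ball of radius 1 or 2.
    have hcrowded : ∀ p ∉ fourSixCorners, ∃ v : Fin 4 × Fin 6, ∃ r < 3, 0 < r ∧
        r < ((insert p fourSixCorners).filter
          fun u => taxicab (gridCoord u) (gridCoord v) ≤ r).card := by
      decide +kernel
    obtain ⟨v, r, -, hr, hvr⟩ := hcrowded p hp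
    exact absurd ((hM.subset (Finset.insert_subset hpM hcorner)).card_filter_taxicab_le v hr)
      (not_le.2 hvr)
  · have h : IsPackingList 4 6 (pinwheel 4 4) :=
      (isPackingList_pinwheel le_rfl le_rfl rfl rfl).mono (by norm_num) (by norm_num) le_rfl
        (by norm_num)
    simpa [length_pinwheel] using h.length_le

theorem theorem1 :
    (∀ n m : ℕ, 4 ≤ n → 4 ≤ m → ¬ (n = 4 ∧ m = 6) → ¬ (n = 6 ∧ m = 4) →
      (gridGraph n m).multipackingNumber = (gridGraph n m).broadcastNumber ∧
      (gridGraph n m).broadcastNumber = n / 2 + m / 2) ∧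
    ((gridGraph 4 6).multipackingNumber = 4 ∧ (gridGraph 4 6).broadcastNumber = 5) ∧
    ((gridGraph 6 4).multipackingNumber = 4 ∧ (gridGraph 6 4).broadcastNumber = 5) := by
  refine ⟨fun n m hn hm h46 h64 => ?_,
    ⟨multipackingNumber_gridGraph_four_six, broadcastNumber_gridGraph_four_six⟩,
    (multipackingNumber_gridGraph_comm 6 4).trans multipackingNumber_gridGraph_four_six,
    (broadcastNumber_gridGraph_comm 6 4).trans broadcastNumber_gridGraph_four_six⟩
  obtain ⟨l, hl, hlen⟩ := exists_isPackingList hn hm h46 h64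
  have h₁ := hl.length_le
  have h₂ := (gridGraph n m).multipackingNumber_le_broadcastNumber
  have h₃ := broadcastNumber_gridGraph_le (n := n) (m := m) (by omega) (by omega)
  omega
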